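/- For $n \in \mathbb{N}$ let $W_{n,n}$ be the set of walks in $\mathbb{N}^2$ from $(0,0)$ to $(n,n)$ all of whose steps are a unit step to the right, $(1,0)$, or a unit step up, $(0,1)$. Choose $w \in W_{n,n}$ uniformly at random, and let $a_2 = a_2(w)$ be the number of $i$ with $1 \le i \le 2n$ such that the walk is on the diagonal $y = x$ after $i$ steps (so the starting point is not counted and, for $n \ge 1$, the end point is). Then, for every $n$, $$ \mathbb{E}[a_2] = \frac{4^n (n!)^2}{(2n)!} - 1, \qquad \operatorname{Var}[a_2] = 4n + 2 - \left(\frac{4^n (n!)^2}{(2n)!}\right)^2 - \frac{4^n (n!)^2}{(2n)!}. $$ Moreover, as $n \to \infty$, the standardized central moments $\mathbb{E}\big[(a_2 - \mathbb{E}[a_2])^k\big] / \operatorname{Var}[a_2]^{k/2}$ for $k = 3, 4, 5$ converge to, respectively, $$ \frac{2\sqrt{\pi}\,(\pi - 3)}{(4-\pi)^{3/2}}, \qquad -\frac{3\pi^2 - 32}{(\pi-4)^2}, \qquad \frac{4\sqrt{\pi}\,(\pi^2 + 5\pi - 25)}{(4-\pi)^{5/2}}. $$ -/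

import Mathlib

open MeasureTheory ProbabilityTheory Filter Topology
open scoped Nat

/-- The two kinds of steps of a walk in the lattice `ℕ × ℕ`: one unit to the right, one unit up. -/
inductive Step where
  | right : Step
  | up : Step

namespace Step

/-- The step as a vector of the lattice. -/
def toVec : Step → ℕ × ℕ
  | right => (1, 0)
  | up => (0, 1)

/-- The value `-1` of a right step, `1` of an up step: the change of (height minus abscissa). -/
def sign : Step → ℤ
  | right => -1
  | up => 1

end Step

/-- A walk starting at the origin, with finitely many up and right steps (of any number):
the string `w = w₁ w₂ ⋯ w_m` of its steps. -/
abbrev Walk : Type := List Step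

namespace Walk

/-- Every set of walks is an event. -/
instance : MeasurableSpace Walk := ⊤

instance : DiscreteMeasurableSpace Walk := ⟨fun _ => trivial⟩

/-- The point of the lattice at which the walk ends. -/
def endpoint (w : Walk) : ℕ × ℕ := (w.map Step.toVec).sum

/-- `w₁ + ⋯ + w_i`, where a right step counts `-1` and an up step `1`: after `i` steps the walk
is on the diagonal `y = x` exactly if this is `0`. -/
def partialSum (w : Walk) (i : ℕ) : ℤ := ((w.take i).map Step.sign).sum

/-- The number of visits to the diagonal `y = x`: the number of times `1 ≤ i ≤ m` (`m` the length)
with `w₁ + ⋯ + w_i = 0`. The starting point is not counted. -/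
def diagonalVisits (w : Walk) : ℕ :=
  ((Finset.Icc 1 w.length).filter fun i => w.partialSum i = 0).card

/-- The set of the walks from the origin to `(n, n)`. -/
def toDiagonal (n : ℕ) : Set Walk := {w | w.endpoint = (n, n)}

/-- The uniform distribution on the walks from the origin to `(n, n)`. -/
noncomputable def uniform (n : ℕ) : Measure Walk := uniformOn (toDiagonal n)

theorem length_eq (w : Walk) : w.length = w.endpoint.1 + w.endpoint.2 := by
  unfold endpoint
  induction w with
  | nil => simp
  | cons s w ih =>
    cases s <;> simp only [List.length_cons, List.map_cons, List.sum_cons, Prod.fst_add,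
      Prod.snd_add, Step.toVec] <;> omega

theorem finite_toDiagonal (n : ℕ) : (toDiagonal n).Finite := by
  have : Finite Step :=
    Finite.of_surjective (fun b : Bool => if b then Step.up else Step.right) (by
      intro s
      cases s
      · exact ⟨false, rfl⟩
      · exact ⟨true, rfl⟩)
  refine (List.finite_length_eq Step (n + n)).subset fun w hw => ?_
  have h : Walk.endpoint w = (n, n) := hw
  simp [length_eq, h]

theorem nonempty_toDiagonal (n : ℕ) : (toDiagonal n).Nonempty := by
  refine ⟨List.replicate n Step.right ++ List.replicate n Step.up, ?_⟩
  simp [toDiagonal, endpoint, Step.toVec]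

instance (n : ℕ) : IsProbabilityMeasure (uniform n) :=
  isProbabilityMeasure_uniformOn (finite_toDiagonal n) (nonempty_toDiagonal n)

/-- The number of visits to the diagonal, as a real random variable. -/
def visits (w : Walk) : ℝ := (w.diagonalVisits : ℝ)

end Walk

/-- The `k`-th standardized central moment `E[(X - E X)^k] / σ^k` of a real random variable `X`
with standard deviation `σ`. -/
noncomputable def standardizedMoment {Ω : Type*} [MeasurableSpace Ω] (X : Ω → ℝ) (k : ℕ)
    (μ : Measure Ω) : ℝ :=
  centralMoment X k μ / √(variance X μ) ^ k

namespace Walk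

open Finset.HasAntidiagonal (antidiagonal mem_antidiagonal)

/-! Let X be the number of visits. Counting time 0, the walk has X + 1 visit times, so (X +
k).choose k counts the multisets of k of them. Such a multiset cuts the walk into k + 1 consecutive,
possibly empty, walks that each start and end on the diagonal. Hence the totals `risingSum k n` have
generating function B^(k+1), where B is the series of central binomial coefficients
(`mk_risingSum`).

Since B² = 1/(1 - 4x) (`centralBinomSeries_sq`), the totals are a polynomial in n times 4^n for odd
k, and times the central binomial coefficient for even k. Dividing by the number of walks leaves
polynomials in n and M = E[X + 1] = 4^n / `n.centralBinom`. Expanding (X + 1 - M)^k in rising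
factorials of X + 1 then gives exact central moments.

For the limits, Wallis' product yields M/√n → √π. The k-th central moment divided by √n^k is a
polynomial in M/√n and 1/√n, so its limit is found by substituting √π and 0. -/

theorem endpoint_append (u v : Walk) : endpoint (u ++ v) = u.endpoint + v.endpoint := by
  simp [endpoint]

/-! ### Counting walks by endpoint. -/

theorem encard_setOf_endpoint_eq :
    ∀ a b : ℕ, {w : Walk | w.endpoint = (a, b)}.encard = ((a + b).choose a : ℕ)
  | 0, 0 => by
    have : {w : Walk | w.endpoint = (0, 0)} = {[]} := by
      ext w
      rcases w with _ | ⟨_ | _, w⟩ <;> simp [endpoint, Step.toVec, Prod.ext_iff]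
    simp [this]
  | a + 1, 0 => by
    have : {w : Walk | w.endpoint = (a + 1, 0)}
        = List.cons Step.right '' {w : Walk | w.endpoint = (a, 0)} := by
      ext w
      rcases w with _ | ⟨_ | _, w⟩ <;> simp [endpoint, Step.toVec, Prod.ext_iff]; omega
    rw [this, List.cons_injective.encard_image, encard_setOf_endpoint_eq a 0]
    simp
  | 0, b + 1 => by
    have : {w : Walk | w.endpoint = (0, b + 1)}
        = List.cons Step.up '' {w : Walk | w.endpoint = (0, b)} := by
      ext w
      rcases w with _ | ⟨_ | _, w⟩ <;> simp [endpoint, Step.toVec, Prod.ext_iff]; omega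
    rw [this, List.cons_injective.encard_image, encard_setOf_endpoint_eq 0 b]
    simp
  | a + 1, b + 1 => by
    have : {w : Walk | w.endpoint = (a + 1, b + 1)}
        = List.cons Step.right '' {w : Walk | w.endpoint = (a, b + 1)}
          ∪ List.cons Step.up '' {w : Walk | w.endpoint = (a + 1, b)} := by
      ext w
      rcases w with _ | ⟨_ | _, w⟩ <;> simp [endpoint, Step.toVec, Prod.ext_iff] <;> omega
    have hdisj : Disjoint (List.cons Step.right '' {w : Walk | w.endpoint = (a, b + 1)})
        (List.cons Step.up '' {w : Walk | w.endpoint = (a + 1, b)}) := by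
      rw [Set.disjoint_left]
      rintro _ ⟨u, -, rfl⟩ ⟨v, -, hv⟩
      simp at hv
    rw [this, Set.encard_union_eq hdisj, List.cons_injective.encard_image,
      List.cons_injective.encard_image, encard_setOf_endpoint_eq a (b + 1),
      encard_setOf_endpoint_eq (a + 1) b, ← Nat.cast_add]
    congr 1
    rw [show a + 1 + (b + 1) = (a + (b + 1)) + 1 by ring, Nat.choose_succ_succ]
    congr 2
    ring

/-- The walks from the origin to `(n, n)`, as a finite set. -/
noncomputable def diagonalFinset (n : ℕ) : Finset Walk := (finite_toDiagonal n).toFinset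

theorem mem_diagonalFinset {n : ℕ} {w : Walk} : w ∈ diagonalFinset n ↔ w.endpoint = (n, n) := by
  simp [diagonalFinset, toDiagonal]

theorem card_diagonalFinset (n : ℕ) : (diagonalFinset n).card = n.centralBinom := by
  have h := encard_setOf_endpoint_eq n n
  have h2 : {w : Walk | w.endpoint = (n, n)} = (diagonalFinset n : Set Walk) := by
    ext w
    simp [mem_diagonalFinset]
  rw [h2, Set.encard_coe_eq_coe_finsetCard, Nat.cast_inj] at h
  rw [h, Nat.centralBinom, two_mul]

theorem sum_sign (w : Walk) : (w.map Step.sign).sum = (w.endpoint.2 : ℤ) - w.endpoint.1 := by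
  induction w with
  | nil => simp [endpoint]
  | cons s w ih =>
    rw [List.map_cons, List.sum_cons, ih]
    cases s <;> simp [endpoint, Step.toVec, Step.sign] <;> ring

/-! ### Diagonal visits and cutting a walk at a visit. -/

theorem partialSum_eq_zero_iff (w : Walk) (i : ℕ) :
    w.partialSum i = 0 ↔ (endpoint (w.take i)).1 = (endpoint (w.take i)).2 := by
  rw [partialSum, sum_sign]
  omega

theorem partialSum_append_of_le (u v : Walk) {i : ℕ} (hi : i ≤ u.length) :
    partialSum (u ++ v) i = partialSum u i := by
  rw [partialSum, partialSum, List.take_append_of_le_length hi]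

theorem diagonalVisits_concat (u : Walk) (s : Step) :
    diagonalVisits (u ++ [s]) =
      u.diagonalVisits + if partialSum (u ++ [s]) (u.length + 1) = 0 then 1 else 0 := by
  have h : ((Finset.Icc 1 u.length).filter fun i => partialSum (u ++ [s]) i = 0)
      = (Finset.Icc 1 u.length).filter fun i => u.partialSum i = 0 :=
    Finset.filter_congr fun i hi => by
      rw [partialSum_append_of_le u [s] (Finset.mem_Icc.1 hi).2]
  rw [diagonalVisits, diagonalVisits, ← h, Finset.card_filter, Finset.card_filter,
    List.length_append, List.length_singleton, Finset.sum_Icc_succ_top (by omega)]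

/-- The times, including `0`, at which the walk is on the diagonal. -/
def visitTimes (w : Walk) : Finset ℕ :=
  (Finset.range (w.length + 1)).filter fun i => w.partialSum i = 0

/-- Hockey-stick identity: along the visit times, starting with 0, the number of visits so far runs
through 0, 1, ..., X. In terms of multisets of k + 1 visit times, i is the largest element. -/
theorem sum_visitTimes_choose (k : ℕ) (w : Walk) :
    ∑ i ∈ w.visitTimes, (diagonalVisits (w.take i) + k).choose k
      = (w.diagonalVisits + (k + 1)).choose (k + 1) := by
  induction w using List.reverseRecOn with
  | nil => simp [visitTimes, partialSum, diagonalVisits]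
  | append_singleton u s ih =>
    have h : ∑ i ∈ Finset.range (u.length + 1), (if partialSum (u ++ [s]) i = 0 then
          (diagonalVisits ((u ++ [s]).take i) + k).choose k else 0)
        = (diagonalVisits u + (k + 1)).choose (k + 1) := by
      rw [← ih, visitTimes, Finset.sum_filter]
      refine Finset.sum_congr rfl fun i hi => ?_
      have hi' : i ≤ u.length := by simpa [Nat.lt_succ_iff] using hi
      rw [partialSum_append_of_le u [s] hi', List.take_append_of_le_length hi']
    rw [visitTimes, Finset.sum_filter, List.length_append, List.length_singleton,
      Finset.sum_range_succ, h, diagonalVisits_concat,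
      List.take_of_length_le (l := u ++ [s]) (by simp), diagonalVisits_concat]
    -- If the new step ends on the diagonal, the extra term is supplied by Pascal's rule; otherwise
    -- nothing changes.
    split_ifs
    · rw [show diagonalVisits u + 1 + (k + 1) = (diagonalVisits u + 1 + k) + 1 by ring,
        Nat.choose_succ_succ,
        show diagonalVisits u + (k + 1) = diagonalVisits u + 1 + k by ring, add_comm]
    · simp

/-- Cutting at a visit is a bijection between walks with a marked visit and pairs of diagonal walks
of total size n. As f sees only the first piece, the second contributes just its count. -/
theorem sum_diagonalFinset_sum_visitTimes (f : Walk → ℕ) (n : ℕ) :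
    ∑ w ∈ diagonalFinset n, ∑ i ∈ w.visitTimes, f (w.take i)
      = ∑ p ∈ antidiagonal n, (∑ u ∈ diagonalFinset p.1, f u) * p.2.centralBinom := by
  have h : ∀ p : ℕ × ℕ, (∑ u ∈ diagonalFinset p.1, f u) * p.2.centralBinom
      = ∑ q ∈ diagonalFinset p.1 ×ˢ diagonalFinset p.2, f q.1 := by
    intro p
    rw [Finset.sum_product, Finset.sum_mul]
    simp [card_diagonalFinset, mul_comm]
  simp_rw [h]
  rw [Finset.sum_sigma', Finset.sum_sigma']
  refine Finset.sum_bij'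
    (fun x _ => ⟨((endpoint (x.1.take x.2)).1, (endpoint (x.1.drop x.2)).1),
      (x.1.take x.2, x.1.drop x.2)⟩)
    (fun y _ => ⟨y.2.1 ++ y.2.2, y.2.1.length⟩) ?_ ?_ ?_ ?_ ?_
  · rintro ⟨w, i⟩ hx
    simp only [Finset.mem_sigma, mem_diagonalFinset, visitTimes, Finset.mem_filter,
      partialSum_eq_zero_iff] at hx
    obtain ⟨hw, -, hi⟩ := hx
    have hs : endpoint (w.take i) + endpoint (w.drop i) = (n, n) := by
      rw [← endpoint_append, List.take_append_drop, hw]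
    simp only [Prod.ext_iff, Prod.fst_add, Prod.snd_add] at hs
    simp only [Finset.mem_sigma, mem_antidiagonal, Finset.mem_product, mem_diagonalFinset,
      Prod.ext_iff, true_and]
    omega
  · rintro ⟨⟨a, b⟩, u, v⟩ hy
    simp only [Finset.mem_sigma, mem_antidiagonal, Finset.mem_product,
      mem_diagonalFinset] at hy
    obtain ⟨hab, hu, hv⟩ := hy
    simp [mem_diagonalFinset, visitTimes, partialSum_eq_zero_iff, endpoint_append, hu, hv, hab]
  · rintro ⟨w, i⟩ hx
    simp only [Finset.mem_sigma, visitTimes, Finset.mem_filter, Finset.mem_range] at hx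
    simp
    omega
  · rintro ⟨⟨a, b⟩, u, v⟩ hy
    simp only [Finset.mem_sigma, mem_antidiagonal, Finset.mem_product,
      mem_diagonalFinset] at hy
    obtain ⟨hab, hu, hv⟩ := hy
    simp [hu, hv]
  · rintro ⟨w, i⟩ _
    rfl

/-! ### Generating functions and closed forms of the rising sums. -/

/-- The total of `(X + k).choose k` over the walks from the origin to `(n, n)`, where `X` is the
number of visits to the diagonal. -/
noncomputable def risingSum (k n : ℕ) : ℕ :=
  ∑ w ∈ diagonalFinset n, (w.diagonalVisits + k).choose k

theorem risingSum_zero (n : ℕ) : risingSum 0 n = n.centralBinom := by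
  simp [risingSum, card_diagonalFinset]

theorem risingSum_succ (k n : ℕ) :
    risingSum (k + 1) n = ∑ p ∈ antidiagonal n, risingSum k p.1 * p.2.centralBinom := by
  unfold risingSum
  rw [← sum_diagonalFinset_sum_visitTimes (fun u => (u.diagonalVisits + k).choose k)]
  exact Finset.sum_congr rfl fun w _ => (sum_visitTimes_choose k w).symm

/-- The generating function of the central binomial coefficients. -/
noncomputable def centralBinomSeries : PowerSeries ℝ :=
  PowerSeries.mk fun n => (n.centralBinom : ℝ)

theorem mk_risingSum (k : ℕ) :
    (PowerSeries.mk fun n => (risingSum k n : ℝ)) = centralBinomSeries ^ (k + 1) := by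
  induction k with
  | zero => simp [risingSum_zero, centralBinomSeries]
  | succ k ih =>
    rw [pow_succ, ← ih]
    ext n
    simp [centralBinomSeries, PowerSeries.coeff_mul, risingSum_succ]

/-- Write S m for the sum. By symmetry, weighting the terms by `p.1` gives m/2 · S m. The recurrence
of the central binomial coefficients turns this weighted sum at n + 1 into 4 · (n/2) · S n + 2 · S
n, so S (n + 1) = 4 · S n. -/
theorem sum_antidiagonal_centralBinom (n : ℕ) :
    ∑ p ∈ antidiagonal n, (p.1.centralBinom : ℝ) * p.2.centralBinom = 4 ^ n := by
  have half : ∀ m : ℕ, ∑ p ∈ antidiagonal m,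
      (p.1 : ℝ) * ((p.1.centralBinom : ℝ) * p.2.centralBinom)
      = m / 2 * ∑ p ∈ antidiagonal m, (p.1.centralBinom : ℝ) * p.2.centralBinom := by
    intro m
    have hswap := Finset.Nat.sum_antidiagonal_swap (n := m)
      (f := fun p : ℕ × ℕ => (p.1 : ℝ) * ((p.1.centralBinom : ℝ) * p.2.centralBinom))
    have hadd : ∑ p ∈ antidiagonal m,
        (p.1 : ℝ) * ((p.1.centralBinom : ℝ) * p.2.centralBinom)
        + ∑ p ∈ antidiagonal m,
          (p.swap.1 : ℝ) * ((p.swap.1.centralBinom : ℝ) * p.swap.2.centralBinom)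
        = m * ∑ p ∈ antidiagonal m, (p.1.centralBinom : ℝ) * p.2.centralBinom := by
      rw [← Finset.sum_add_distrib, Finset.mul_sum]
      refine Finset.sum_congr rfl fun p hp => ?_
      rw [← mem_antidiagonal.1 hp]
      simp only [Prod.fst_swap, Prod.snd_swap]
      push_cast
      ring
    linarith
  induction n with
  | zero => simp
  | succ n ih =>
    have h1 := half (n + 1)
    -- The term split off has `p.1 = 0`, so its weight kills it.
    rw [Finset.Nat.sum_antidiagonal_succ] at h1
    have h2 : ∑ p ∈ antidiagonal n,
        ((p.1 + 1 : ℕ) : ℝ) * (((p.1 + 1).centralBinom : ℝ) * p.2.centralBinom)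
        = ∑ p ∈ antidiagonal n,
            (4 * ((p.1 : ℝ) * ((p.1.centralBinom : ℝ) * p.2.centralBinom))
              + 2 * ((p.1.centralBinom : ℝ) * p.2.centralBinom)) := by
      refine Finset.sum_congr rfl fun p _ => ?_
      have h3 : ((p.1 + 1 : ℕ) : ℝ) * ((p.1 + 1).centralBinom : ℝ)
          = 2 * (2 * p.1 + 1) * p.1.centralBinom := by
        exact_mod_cast Nat.succ_mul_centralBinom_succ p.1
      rw [← mul_assoc, h3]
      ring
    rw [h2, Finset.sum_add_distrib, ← Finset.mul_sum, ← Finset.mul_sum, half n, ih] at h1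
    have hn : ((n : ℝ) + 1) ≠ 0 := by positivity
    apply mul_left_cancel₀ hn
    push_cast at h1
    rw [pow_succ]
    linarith

theorem centralBinomSeries_sq : centralBinomSeries ^ 2 = PowerSeries.mk fun n => (4 : ℝ) ^ n := by
  ext n
  rw [sq, PowerSeries.coeff_mul, PowerSeries.coeff_mk, ← sum_antidiagonal_centralBinom n]
  simp [centralBinomSeries]

/-- The recurrence says that (1 - 4x) times the series of b is the series of a. -/
theorem mk_mul_mk_four_pow {a b : ℕ → ℝ} (h0 : b 0 = a 0)
    (h : ∀ n, b (n + 1) = 4 * b n + a (n + 1)) :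
    (PowerSeries.mk a * PowerSeries.mk fun n => (4 : ℝ) ^ n) = PowerSeries.mk b := by
  ext n
  rw [PowerSeries.coeff_mul]
  simp only [PowerSeries.coeff_mk]
  induction n with
  | zero => simp [h0]
  | succ n ih =>
    rw [Finset.Nat.sum_antidiagonal_succ', h, ← ih, Finset.mul_sum]
    simp only [pow_succ, pow_zero, mul_one, add_comm (a (n + 1))]
    congr 1
    exact Finset.sum_congr rfl fun p _ => by ring

theorem risingSum_one (n : ℕ) : (risingSum 1 n : ℝ) = 4 ^ n := by
  have h := mk_risingSum 1
  rw [centralBinomSeries_sq] at h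
  simpa using congrArg (PowerSeries.coeff n) h

/-- Two more factors B amount to one factor 1/(1 - 4x), so a proposed closed form need only satisfy
a first-order recurrence. -/
theorem risingSum_add_two {k : ℕ} {b : ℕ → ℝ} (h0 : b 0 = risingSum k 0)
    (h : ∀ n, b (n + 1) = 4 * b n + risingSum k (n + 1)) (n : ℕ) :
    (risingSum (k + 2) n : ℝ) = b n := by
  have h2 := mk_risingSum (k + 2)
  rw [show k + 2 + 1 = k + 1 + 2 by ring, pow_add, ← mk_risingSum, centralBinomSeries_sq,
    mk_mul_mk_four_pow h0 h] at h2
  simpa using congrArg (PowerSeries.coeff n) h2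

theorem centralBinom_succ_cast (n : ℕ) : ((n : ℝ) + 1) * ((n + 1).centralBinom : ℝ)
    = 2 * (2 * n + 1) * n.centralBinom := by
  exact_mod_cast Nat.succ_mul_centralBinom_succ n

theorem risingSum_two (n : ℕ) : (risingSum 2 n : ℝ) = (2 * n + 1) * n.centralBinom := by
  refine risingSum_add_two (k := 0) (b := fun n => (2 * n + 1) * (n.centralBinom : ℝ)) ?_ ?_ n
  · simp [risingSum_zero]
  · intro n
    have h := centralBinom_succ_cast n
    rw [risingSum_zero]
    push_cast
    linarith

theorem risingSum_three (n : ℕ) : (risingSum 3 n : ℝ) = (n + 1) * 4 ^ n := by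
  refine risingSum_add_two (k := 1) (b := fun n => ((n : ℝ) + 1) * 4 ^ n) ?_ ?_ n
  · simp [risingSum_one]
  · intro n
    rw [risingSum_one]
    push_cast
    ring

theorem risingSum_four (n : ℕ) :
    (risingSum 4 n : ℝ) = (2 * n + 1) * (2 * n + 3) / 3 * n.centralBinom := by
  refine risingSum_add_two (k := 2)
    (b := fun n => (2 * n + 1) * (2 * n + 3) / 3 * (n.centralBinom : ℝ)) ?_ ?_ n
  · simp [risingSum_two]
  · intro n
    have h := centralBinom_succ_cast n
    rw [risingSum_two]
    push_cast
    linear_combination (2 / 3 * (2 * (n : ℝ) + 3)) * h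

theorem risingSum_five (n : ℕ) : (risingSum 5 n : ℝ) = (n + 1) * (n + 2) / 2 * 4 ^ n := by
  refine risingSum_add_two (k := 3) (b := fun n => ((n : ℝ) + 1) * (n + 2) / 2 * 4 ^ n) ?_ ?_ n
  · simp [risingSum_three]
  · intro n
    rw [risingSum_three]
    push_cast
    ring

/-! ### Exact mean and central moments. -/

theorem integral_uniform (n : ℕ) (f : Walk → ℝ) :
    ∫ w, f w ∂(uniform n) = (∑ w ∈ diagonalFinset n, f w) / n.centralBinom := by
  have hS : toDiagonal n = (diagonalFinset n : Set Walk) := by simp [diagonalFinset]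
  rw [uniform, uniformOn, ProbabilityTheory.cond, integral_smul_measure, hS,
    Measure.count_apply_finset, card_diagonalFinset, setIntegral_finset]
  · simp [div_eq_inv_mul]
  · rw [← Set.biUnion_of_singleton (diagonalFinset n : Set Walk),
      integrableOn_finite_biUnion (Finset.finite_toSet _)]
    exact fun w _ => integrableOn_singleton
      (hx := by rw [Measure.count_singleton]; exact ENNReal.one_lt_top)

/-- The mean of `X + 1`, where `X` is the number of visits to the diagonal. -/
noncomputable def meanSucc (n : ℕ) : ℝ := 4 ^ n * (n ! : ℝ) ^ 2 / ((2 * n) ! : ℝ)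

theorem meanSucc_eq (n : ℕ) : meanSucc n = 4 ^ n / n.centralBinom := by
  have h : (n.centralBinom : ℝ) * (n ! : ℝ) * (n ! : ℝ) = ((2 * n) ! : ℝ) := by
    have := Nat.add_choose_mul_factorial_mul_factorial n n
    rw [← two_mul, ← Nat.centralBinom_eq_two_mul_choose] at this
    exact_mod_cast this
  have h1 : (n ! : ℝ) ≠ 0 := by positivity
  have h2 : (n.centralBinom : ℝ) ≠ 0 := by exact_mod_cast n.centralBinom_ne_zero
  rw [meanSucc, ← h]
  field_simp

theorem sum_choose_cast (k n : ℕ) :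
    ∑ w ∈ diagonalFinset n, (((w.diagonalVisits + k).choose k : ℕ) : ℝ) = risingSum k n := by
  simp [risingSum]

theorem factorial_mul_choose_cast (x k : ℕ) :
    (k ! : ℝ) * ((x + k).choose k : ℕ) = ∏ i ∈ Finset.range k, ((x : ℝ) + 1 + i) := by
  have h := Nat.ascFactorial_eq_factorial_mul_choose x k
  rw [Nat.ascFactorial_eq_prod_range] at h
  exact_mod_cast h.symm

section ChooseCast

variable (x : ℕ)

theorem choose_one_cast : (((x + 1).choose 1 : ℕ) : ℝ) = x + 1 := by simp

theorem choose_two_cast : 2 * (((x + 2).choose 2 : ℕ) : ℝ) = (x + 1) * (x + 2) := by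
  have h := factorial_mul_choose_cast x 2
  norm_num [Finset.prod_range_succ, Nat.factorial] at h
  linear_combination h

theorem choose_three_cast :
    6 * (((x + 3).choose 3 : ℕ) : ℝ) = (x + 1) * (x + 2) * (x + 3) := by
  have h := factorial_mul_choose_cast x 3
  norm_num [Finset.prod_range_succ, Nat.factorial] at h
  linear_combination h

theorem choose_four_cast :
    24 * (((x + 4).choose 4 : ℕ) : ℝ) = (x + 1) * (x + 2) * (x + 3) * (x + 4) := by
  have h := factorial_mul_choose_cast x 4
  norm_num [Finset.prod_range_succ, Nat.factorial] at h
  linear_combination h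

theorem choose_five_cast :
    120 * (((x + 5).choose 5 : ℕ) : ℝ) = (x + 1) * (x + 2) * (x + 3) * (x + 4) * (x + 5) := by
  have h := factorial_mul_choose_cast x 5
  norm_num [Finset.prod_range_succ, Nat.factorial] at h
  linear_combination h

end ChooseCast

theorem integral_visits (n : ℕ) : ∫ w, visits w ∂(uniform n) = meanSucc n - 1 := by
  have hC : (n.centralBinom : ℝ) ≠ 0 := by exact_mod_cast n.centralBinom_ne_zero
  have h := sum_choose_cast 1 n
  simp only [choose_one_cast, Finset.sum_add_distrib, Finset.sum_const, card_diagonalFinset,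
    nsmul_eq_mul, mul_one, risingSum_one] at h
  rw [integral_uniform, meanSucc_eq]
  simp only [visits]
  field_simp
  linarith

theorem centralMoment_visits (k n : ℕ) :
    centralMoment visits k (uniform n)
      = (∑ w ∈ diagonalFinset n, ((w.diagonalVisits : ℝ) + 1 - meanSucc n) ^ k)
        / n.centralBinom := by
  rw [centralMoment, integral_uniform]
  simp only [Pi.pow_apply, Pi.sub_apply, integral_visits]
  simp only [visits]
  congr 1
  exact Finset.sum_congr rfl fun w _ => by ring

/-- A power of `X + 1 - c` that is a combination of the `(X + j).choose j` is averaged by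
averaging these. -/
theorem sum_sub_pow_eq {k : ℕ} {c : ℝ} (a : ℕ → ℝ)
    (h : ∀ x : ℕ, ((x : ℝ) + 1 - c) ^ k
      = ∑ j ∈ Finset.range (k + 1), a j * (((x + j).choose j : ℕ) : ℝ)) (n : ℕ) :
    ∑ w ∈ diagonalFinset n, ((w.diagonalVisits : ℝ) + 1 - c) ^ k
      = ∑ j ∈ Finset.range (k + 1), a j * risingSum j n := by
  simp_rw [h, ← sum_choose_cast, Finset.mul_sum]
  exact Finset.sum_comm

theorem centralMoment_visits_two (n : ℕ) :
    centralMoment visits 2 (uniform n) = 4 * n + 2 - meanSucc n ^ 2 - meanSucc n := by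
  have hC : (n.centralBinom : ℝ) ≠ 0 := by exact_mod_cast n.centralBinom_ne_zero
  have hM : (4 : ℝ) ^ n = meanSucc n * n.centralBinom := by
    rw [meanSucc_eq, div_mul_cancel₀ _ hC]
  rw [centralMoment_visits]
  set c := meanSucc n
  -- The coefficients, here and for the higher moments, expand (y - c)^k with y = x + 1 in the
  -- rising factorials y(y + 1)⋯(y + j - 1) = j! · (x + j).choose j, with j! absorbed.
  rw [div_eq_iff hC, sum_sub_pow_eq (fun j => if j = 0 then c ^ 2
    else if j = 1 then -(1 + 2 * c) else 2)]
  · simp only [Finset.sum_range_succ, Finset.range_zero, Finset.sum_empty]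
    norm_num [risingSum_zero, risingSum_one, risingSum_two, hM]
    ring
  · intro x
    have h2 := choose_two_cast x
    simp only [Finset.sum_range_succ, Finset.range_zero, Finset.sum_empty, choose_one_cast]
    norm_num
    linear_combination -h2

theorem centralMoment_visits_three (n : ℕ) :
    centralMoment visits 3 (uniform n)
      = 6 * (n + 1) * meanSucc n - 6 * (1 + meanSucc n) * (2 * n + 1)
        + (1 + 3 * meanSucc n + 3 * meanSucc n ^ 2) * meanSucc n - meanSucc n ^ 3 := by
  have hC : (n.centralBinom : ℝ) ≠ 0 := by exact_mod_cast n.centralBinom_ne_zero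
  have hM : (4 : ℝ) ^ n = meanSucc n * n.centralBinom := by
    rw [meanSucc_eq, div_mul_cancel₀ _ hC]
  rw [centralMoment_visits]
  set c := meanSucc n
  rw [div_eq_iff hC, sum_sub_pow_eq (fun j => if j = 0 then -c ^ 3
    else if j = 1 then 1 + 3 * c + 3 * c ^ 2 else if j = 2 then -(6 * (1 + c)) else 6)]
  · simp only [Finset.sum_range_succ, Finset.range_zero, Finset.sum_empty]
    norm_num [risingSum_zero, risingSum_one, risingSum_two, risingSum_three, hM]
    ring
  · intro x
    have h2 := choose_two_cast x
    have h3 := choose_three_cast x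
    simp only [Finset.sum_range_succ, Finset.range_zero, Finset.sum_empty, choose_one_cast]
    norm_num
    linear_combination 3 * (1 + c) * h2 - h3

theorem centralMoment_visits_four (n : ℕ) :
    centralMoment visits 4 (uniform n)
      = 8 * ((2 * n + 1) * (2 * n + 3)) - 6 * (6 + 4 * meanSucc n) * (n + 1) * meanSucc n
        + 2 * (7 + 12 * meanSucc n + 6 * meanSucc n ^ 2) * (2 * n + 1)
        - (1 + 4 * meanSucc n + 6 * meanSucc n ^ 2 + 4 * meanSucc n ^ 3) * meanSucc n
        + meanSucc n ^ 4 := by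
  have hC : (n.centralBinom : ℝ) ≠ 0 := by exact_mod_cast n.centralBinom_ne_zero
  have hM : (4 : ℝ) ^ n = meanSucc n * n.centralBinom := by
    rw [meanSucc_eq, div_mul_cancel₀ _ hC]
  rw [centralMoment_visits]
  set c := meanSucc n
  rw [div_eq_iff hC, sum_sub_pow_eq (fun j => if j = 0 then c ^ 4
    else if j = 1 then -(1 + 4 * c + 6 * c ^ 2 + 4 * c ^ 3)
    else if j = 2 then 2 * (7 + 12 * c + 6 * c ^ 2)
    else if j = 3 then -(6 * (6 + 4 * c)) else 24)]
  · simp only [Finset.sum_range_succ, Finset.range_zero, Finset.sum_empty]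
    norm_num [risingSum_zero, risingSum_one, risingSum_two, risingSum_three, risingSum_four, hM]
    ring
  · intro x
    have h2 := choose_two_cast x
    have h3 := choose_three_cast x
    have h4 := choose_four_cast x
    simp only [Finset.sum_range_succ, Finset.range_zero, Finset.sum_empty, choose_one_cast]
    norm_num
    linear_combination -(7 + 12 * c + 6 * c ^ 2) * h2 + (6 + 4 * c) * h3 - h4

theorem centralMoment_visits_five (n : ℕ) :
    centralMoment visits 5 (uniform n)
      = 60 * ((n + 1) * (n + 2)) * meanSucc n
        - 8 * (10 + 5 * meanSucc n) * ((2 * n + 1) * (2 * n + 3))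
        + 6 * (25 + 30 * meanSucc n + 10 * meanSucc n ^ 2) * (n + 1) * meanSucc n
        - 2 * (15 + 35 * meanSucc n + 30 * meanSucc n ^ 2 + 10 * meanSucc n ^ 3) * (2 * n + 1)
        + (1 + 5 * meanSucc n + 10 * meanSucc n ^ 2 + 10 * meanSucc n ^ 3 + 5 * meanSucc n ^ 4)
          * meanSucc n
        - meanSucc n ^ 5 := by
  have hC : (n.centralBinom : ℝ) ≠ 0 := by exact_mod_cast n.centralBinom_ne_zero
  have hM : (4 : ℝ) ^ n = meanSucc n * n.centralBinom := by
    rw [meanSucc_eq, div_mul_cancel₀ _ hC]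
  rw [centralMoment_visits]
  set c := meanSucc n
  rw [div_eq_iff hC, sum_sub_pow_eq (fun j => if j = 0 then -c ^ 5
    else if j = 1 then 1 + 5 * c + 10 * c ^ 2 + 10 * c ^ 3 + 5 * c ^ 4
    else if j = 2 then -(2 * (15 + 35 * c + 30 * c ^ 2 + 10 * c ^ 3))
    else if j = 3 then 6 * (25 + 30 * c + 10 * c ^ 2)
    else if j = 4 then -(24 * (10 + 5 * c)) else 120)]
  · simp only [Finset.sum_range_succ, Finset.range_zero, Finset.sum_empty]
    norm_num [risingSum_zero, risingSum_one, risingSum_two, risingSum_three, risingSum_four,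
      risingSum_five, hM]
    ring
  · intro x
    have h2 := choose_two_cast x
    have h3 := choose_three_cast x
    have h4 := choose_four_cast x
    have h5 := choose_five_cast x
    simp only [Finset.sum_range_succ, Finset.range_zero, Finset.sum_empty, choose_one_cast]
    norm_num
    linear_combination (15 + 35 * c + 30 * c ^ 2 + 10 * c ^ 3) * h2
      - (25 + 30 * c + 10 * c ^ 2) * h3 + (10 + 5 * c) * h4 - h5

theorem variance_visits (n : ℕ) :
    variance visits (uniform n) = 4 * n + 2 - meanSucc n ^ 2 - meanSucc n := by
  rw [← centralMoment_visits_two,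
    centralMoment_two_eq_variance (measurable_from_top (f := visits)).aemeasurable]

/-! ### Asymptotics. -/

theorem meanSucc_nonneg (n : ℕ) : 0 ≤ meanSucc n := by
  unfold meanSucc
  positivity

theorem tendsto_inv_sqrt_natCast : Tendsto (fun n : ℕ => (√(n : ℝ))⁻¹) atTop (𝓝 0) :=
  tendsto_inv_atTop_zero.comp (Real.tendsto_sqrt_atTop.comp tendsto_natCast_atTop_atTop)

/-- With W the Wallis product, M² = W n · (2n + 1), so M²/n = W n · (2 + 1/n) → (π/2) · 2. -/
theorem tendsto_meanSucc_div_sqrt :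
    Tendsto (fun n : ℕ => meanSucc n / √(n : ℝ)) atTop (𝓝 √Real.pi) := by
  have h : Tendsto (fun n : ℕ => √(Real.Wallis.W n * (2 + (√(n : ℝ))⁻¹ ^ 2))) atTop
      (𝓝 √(Real.pi / 2 * (2 + 0 ^ 2))) :=
    (Real.Wallis.tendsto_W_nhds_pi_div_two.mul
      ((tendsto_inv_sqrt_natCast.pow 2).const_add 2)).sqrt
  rw [show Real.pi / 2 * (2 + 0 ^ 2) = Real.pi by ring] at h
  refine h.congr' ?_
  filter_upwards [eventually_gt_atTop 0] with n hn
  have hn' : (0 : ℝ) < n := by exact_mod_cast hn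
  have h0 : 0 ≤ meanSucc n / √(n : ℝ) := div_nonneg (meanSucc_nonneg n) (Real.sqrt_nonneg _)
  rw [← Real.sqrt_sq h0]
  congr 1
  rw [Real.Wallis.W_eq_factorial_ratio, div_pow, inv_pow, Real.sq_sqrt hn'.le, meanSucc,
    pow_mul]
  have h1 : ((2 * n) ! : ℝ) ≠ 0 := by positivity
  field_simp
  rw [show (2 : ℝ) ^ 4 = 4 ^ 2 by norm_num, ← pow_mul, ← pow_mul, mul_comm 2 n]

/-- The limit of an expression in the rescaled mean and the inverse of the scale. -/
theorem tendsto_of_scaled {g : ℕ → ℝ} {P : ℝ → ℝ → ℝ} (hP : Continuous fun p : ℝ × ℝ => P p.1 p.2)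
    (h : ∀ n : ℕ, ∀ r s : ℝ, 0 < s → (n : ℝ) = s ^ 2 → meanSucc n = r * s → g n = P r s⁻¹) :
    Tendsto g atTop (𝓝 (P √Real.pi 0)) := by
  have h1 := (hP.tendsto (√Real.pi, 0)).comp
    (tendsto_meanSucc_div_sqrt.prodMk_nhds tendsto_inv_sqrt_natCast)
  refine h1.congr' ?_
  filter_upwards [eventually_gt_atTop 0] with n hn
  have hs : 0 < √(n : ℝ) := Real.sqrt_pos.2 (by exact_mod_cast hn)
  exact (h n _ _ hs (Real.sq_sqrt (Nat.cast_nonneg n)).symm (div_mul_cancel₀ _ hs.ne').symm).symm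

/-- Here and below, P comes from substituting n = s² and M = r s in the exact formula, dividing by
s^k, and writing t = 1/s. -/
theorem tendsto_variance_div :
    Tendsto (fun n : ℕ => variance visits (uniform n) / √(n : ℝ) ^ 2) atTop
      (𝓝 (4 - Real.pi)) := by
  have h := tendsto_of_scaled (g := fun n : ℕ => variance visits (uniform n) / √(n : ℝ) ^ 2)
    (P := fun r t => 4 + 2 * t ^ 2 - r ^ 2 - r * t) (by fun_prop) ?_
  · convert h using 2
    rw [Real.sq_sqrt Real.pi_pos.le]
    ring
  · intro n r s hs hn hM
    rw [variance_visits, hM, hn, Real.sqrt_sq hs.le]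
    field_simp

theorem tendsto_centralMoment_three_div :
    Tendsto (fun n : ℕ => centralMoment visits 3 (uniform n) / √(n : ℝ) ^ 3) atTop
      (𝓝 (2 * √Real.pi * (Real.pi - 3))) := by
  have h := tendsto_of_scaled
    (g := fun n : ℕ => centralMoment visits 3 (uniform n) / √(n : ℝ) ^ 3)
    (P := fun r t => 6 * (1 + t ^ 2) * r - 6 * (t + r) * (2 + t ^ 2)
      + (t ^ 2 + 3 * r * t + 3 * r ^ 2) * r - r ^ 3) (by fun_prop) ?_
  · convert h using 2
    linear_combination (-2 * √Real.pi) * Real.sq_sqrt Real.pi_pos.le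
  · intro n r s hs hn hM
    rw [centralMoment_visits_three, hM, hn, Real.sqrt_sq hs.le]
    field_simp

theorem tendsto_centralMoment_four_div :
    Tendsto (fun n : ℕ => centralMoment visits 4 (uniform n) / √(n : ℝ) ^ 4) atTop
      (𝓝 (32 - 3 * Real.pi ^ 2)) := by
  have h := tendsto_of_scaled
    (g := fun n : ℕ => centralMoment visits 4 (uniform n) / √(n : ℝ) ^ 4)
    (P := fun r t => 8 * ((2 + t ^ 2) * (2 + 3 * t ^ 2)) - 6 * (6 * t + 4 * r) * (1 + t ^ 2) * r
      + 2 * (7 * t ^ 2 + 12 * r * t + 6 * r ^ 2) * (2 + t ^ 2)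
      - (t ^ 3 + 4 * r * t ^ 2 + 6 * r ^ 2 * t + 4 * r ^ 3) * r + r ^ 4) (by fun_prop) ?_
  · convert h using 2
    linear_combination 3 * (√Real.pi ^ 2 + Real.pi) * Real.sq_sqrt Real.pi_pos.le
  · intro n r s hs hn hM
    rw [centralMoment_visits_four, hM, hn, Real.sqrt_sq hs.le]
    field_simp

theorem tendsto_centralMoment_five_div :
    Tendsto (fun n : ℕ => centralMoment visits 5 (uniform n) / √(n : ℝ) ^ 5) atTop
      (𝓝 (4 * √Real.pi * (Real.pi ^ 2 + 5 * Real.pi - 25))) := by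
  have h := tendsto_of_scaled
    (g := fun n : ℕ => centralMoment visits 5 (uniform n) / √(n : ℝ) ^ 5)
    (P := fun r t => 60 * ((1 + t ^ 2) * (1 + 2 * t ^ 2)) * r
      - 8 * (10 * t + 5 * r) * ((2 + t ^ 2) * (2 + 3 * t ^ 2))
      + 6 * (25 * t ^ 2 + 30 * r * t + 10 * r ^ 2) * (1 + t ^ 2) * r
      - 2 * (15 * t ^ 3 + 35 * r * t ^ 2 + 30 * r ^ 2 * t + 10 * r ^ 3) * (2 + t ^ 2)
      + (t ^ 4 + 5 * r * t ^ 3 + 10 * r ^ 2 * t ^ 2 + 10 * r ^ 3 * t + 5 * r ^ 4) * r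
      - r ^ 5) (by fun_prop) ?_
  · convert h using 2
    linear_combination (-4 * √Real.pi * (√Real.pi ^ 2 + Real.pi + 5)) *
      Real.sq_sqrt Real.pi_pos.le
  · intro n r s hs hn hM
    rw [centralMoment_visits_five, hM, hn, Real.sqrt_sq hs.le]
    field_simp

/-- The scaling √n^k cancels between the central moment and the power of the standard deviation; π <
4 keeps the limiting denominator nonzero. -/
theorem tendsto_standardizedMoment {k : ℕ} {c : ℝ}
    (h : Tendsto (fun n : ℕ => centralMoment visits k (uniform n) / √(n : ℝ) ^ k) atTop (𝓝 c)) :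
    Tendsto (fun n : ℕ => standardizedMoment visits k (uniform n)) atTop
      (𝓝 (c / √(4 - Real.pi) ^ k)) := by
  have hpi : √(4 - Real.pi) ^ k ≠ 0 :=
    pow_ne_zero _ (Real.sqrt_pos.2 (sub_pos.2 Real.pi_lt_four)).ne'
  refine (h.div (tendsto_variance_div.sqrt.pow k) hpi).congr' ?_
  filter_upwards [eventually_gt_atTop 0] with n hn
  have hs : √(n : ℝ) ≠ 0 := (Real.sqrt_pos.2 (by exact_mod_cast hn)).ne'
  rw [Pi.div_apply, standardizedMoment, Real.sqrt_div (variance_nonneg _ _),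
    Real.sqrt_sq (Real.sqrt_nonneg _), div_pow, div_div_div_cancel_right₀ (pow_ne_zero _ hs)]

end Walk

theorem Real.rpow_div_two_eq_sqrt_pow {x : ℝ} (hx : 0 ≤ x) (k : ℕ) :
    x ^ ((k : ℝ) / 2) = √x ^ k := by
  rw [Real.rpow_div_two_eq_sqrt _ hx, Real.rpow_natCast]

theorem proposition2 :
    (∀ n : ℕ,
      ∫ w, Walk.visits w ∂(Walk.uniform n)
        = 4 ^ n * (n ! : ℝ) ^ 2 / ((2 * n) ! : ℝ) - 1) ∧
    (∀ n : ℕ,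
      variance Walk.visits (Walk.uniform n)
        = 4 * (n : ℝ) + 2 - (4 ^ n * (n ! : ℝ) ^ 2 / ((2 * n) ! : ℝ)) ^ 2
          - 4 ^ n * (n ! : ℝ) ^ 2 / ((2 * n) ! : ℝ)) ∧
    Tendsto (fun n : ℕ => standardizedMoment Walk.visits 3 (Walk.uniform n)) atTop
      (𝓝 (2 * √Real.pi * (Real.pi - 3) / (4 - Real.pi) ^ (3 / 2 : ℝ))) ∧
    Tendsto (fun n : ℕ => standardizedMoment Walk.visits 4 (Walk.uniform n)) atTop
      (𝓝 (-((3 * Real.pi ^ 2 - 32) / (Real.pi - 4) ^ 2))) ∧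
    Tendsto (fun n : ℕ => standardizedMoment Walk.visits 5 (Walk.uniform n)) atTop
      (𝓝 (4 * √Real.pi * (Real.pi ^ 2 + 5 * Real.pi - 25) / (4 - Real.pi) ^ (5 / 2 : ℝ))) := by
  have hpi : 0 ≤ 4 - Real.pi := (sub_pos.2 Real.pi_lt_four).le
  refine ⟨Walk.integral_visits, Walk.variance_visits, ?_, ?_, ?_⟩
  · rw [show (3 / 2 : ℝ) = ((3 : ℕ) : ℝ) / 2 by norm_num, Real.rpow_div_two_eq_sqrt_pow hpi]
    exact Walk.tendsto_standardizedMoment Walk.tendsto_centralMoment_three_div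
  · have h := Walk.tendsto_standardizedMoment Walk.tendsto_centralMoment_four_div
    rw [show √(4 - Real.pi) ^ 4 = (√(4 - Real.pi) ^ 2) ^ 2 by ring, Real.sq_sqrt hpi] at h
    convert h using 2
    rw [← neg_div, show (Real.pi - 4) ^ 2 = (4 - Real.pi) ^ 2 by ring, neg_sub]
  · rw [show (5 / 2 : ℝ) = ((5 : ℕ) : ℝ) / 2 by norm_num, Real.rpow_div_two_eq_sqrt_pow hpi]
    exact Walk.tendsto_standardizedMoment Walk.tendsto_centralMoment_five_div
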